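/- All topological groups are Hausdorff. A group topology on an abelian group $G$ is called precompact if it is Hausdorff and for every neighbourhood $U$ of $0$ there is a finite set $F\subseteq G$ with $F+U=G$. A precompact abelian group $(G,\tau)$ is called ss-characterized if there is a sequence $(u_n)_{n\in\mathbb N}$ in $G$ such that $\tau$ is the finest precompact group topology on $G$ in which $u_n\to 0$. The quasi-component $Q(G)$ is the intersection of all clopen subsets of $G$ containing $0$. Corollary 3.4. Let $(G,\tau)$ be an ss-characterized precompact abelian group. Then $G$ is hereditarily disconnected, that is, the connected component of $0$ in $G$ is $\{0\}$. Moreover, the quasi-component $Q(G)$ is contained in a countable subgroup of $G$. -/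

import Mathlib

open Filter Topology

/-- A group topology `τ` on the abelian group `G` is precompact: it is a Hausdorff group topology
and `G` is totally bounded for the associated group uniformity. -/
structure IsPrecompactGroupTopology {G : Type*} [AddCommGroup G] (τ : TopologicalSpace G) : Prop
    extends IsTopologicalAddGroup G, T2Space G where
  totallyBounded :
    letI : UniformSpace G := IsTopologicalAddGroup.rightUniformSpace G
    TotallyBounded (Set.univ : Set G)

/-- The precompact group topologies on `G` in which the sequence `u` converges to `0`. -/
def precompactTopologiesConverging {G : Type*} [AddCommGroup G] (u : ℕ → G) :
    Set (TopologicalSpace G) :=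
  {τ | IsPrecompactGroupTopology τ ∧ Tendsto u atTop (@nhds G τ 0)}

/-- `u` is a TB-sequence: it converges to `0` in some precompact group topology on `G`. -/
def IsTBSequence {G : Type*} [AddCommGroup G] (u : ℕ → G) : Prop :=
  (precompactTopologiesConverging u).Nonempty

/-- `u` characterizes `τ`: `u` is a TB-sequence and `τ` is the finest precompact group topology on
`G` in which `u` converges to `0`. In Mathlib's order on topologies, finer means smaller, so the
finest topology is the least element. -/
def CharacterizesTopology {G : Type*} [AddCommGroup G] (u : ℕ → G) (τ : TopologicalSpace G) :
    Prop :=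
  IsTBSequence u ∧ IsLeast (precompactTopologiesConverging u) τ

/-- `(G, τ)` is a single sequence characterized (ss-characterized) precompact group. -/
def IsSSCharacterized {G : Type*} [AddCommGroup G] (τ : TopologicalSpace G) : Prop :=
  IsPrecompactGroupTopology τ ∧ ∃ u : ℕ → G, CharacterizesTopology u τ

/-- The quasi-component of a topological group: the intersection of all clopen sets containing the
neutral element. -/
def quasiComponent (G : Type*) [AddCommGroup G] [TopologicalSpace G] : Set G :=
  ⋂₀ {Z : Set G | IsClopen Z ∧ (0 : G) ∈ Z}

/-- A topological group is hereditarily disconnected if the connected component of the neutral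
element is trivial. -/
def IsHereditarilyDisconnected (G : Type*) [AddCommGroup G] [TopologicalSpace G] : Prop :=
  connectedComponent (0 : G) = {0}

/-! Let H be the countable subgroup generated by u. Refining τ by a character that kills H keeps it
precompact and keeps u null, so τ, being finest, already makes that character continuous. For g
outside H, such a character can be chosen nonzero at g with values in ℚ/ℤ; its countable range
yields a clopen set containing 0 but not g. Hence Q(G) ⊆ H, and the component of 0 is a countable
connected set in a Tychonoff space, so trivial. -/

/-- Refining a precompact group topology by a homomorphism into a totally bounded group yields a
precompact group topology. -/
theorem IsPrecompactGroupTopology.inf_induced {G K : Type*} [AddCommGroup G] [AddCommGroup K]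
    [UniformSpace K] [IsUniformAddGroup K] (hK : TotallyBounded (Set.univ : Set K))
    {τ : TopologicalSpace G} (hτ : IsPrecompactGroupTopology τ) (φ : G →+ K) :
    IsPrecompactGroupTopology (τ ⊓ TopologicalSpace.induced φ inferInstance) := by
  have hgrp := hτ.toIsTopologicalAddGroup
  let u : UniformSpace G := IsTopologicalAddGroup.rightUniformSpace G
  have hu : @IsUniformAddGroup G u _ := isUniformAddGroup_of_addCommGroup
  let v : UniformSpace G := UniformSpace.comap φ inferInstance
  have hv : @IsUniformAddGroup G v _ := IsUniformAddGroup.comap φ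
  let w : UniformSpace G := u ⊓ v
  have hw : @IsUniformAddGroup G w _ := isUniformAddGroup_inf hu hv
  refine @IsPrecompactGroupTopology.mk G _ _ (@IsUniformAddGroup.to_topologicalAddGroup G w _ hw)
    ?_ ?_
  · exact @T2Space.mk G (_) fun x y hxy => by
      obtain ⟨U, V, hU, hV, hx, hy, hUV⟩ := hτ.toT2Space.t2 hxy
      exact ⟨U, V, inf_le_left (a := τ) _ hU, inf_le_left (a := τ) _ hV, hx, hy, hUV⟩
  · have hright := @IsUniformAddGroup.rightUniformSpace_eq G w _ hw
    change @TotallyBounded G (@IsTopologicalAddGroup.rightUniformSpace G _ w.toTopologicalSpace _) _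
    -- Via ultrafilters, total boundedness passes to the infimum: Cauchy for `w` means Cauchy for
    -- both `u` and `v`.
    rw [hright, @totallyBounded_iff_ultrafilter G w]
    intro f _
    refine cauchy_inf_uniformSpace.2 ⟨?_, ?_⟩
    · exact (@totallyBounded_iff_ultrafilter G u _).1 hτ.totallyBounded f (by simp)
    · refine cauchy_comap_uniformSpace.2 ?_
      exact totallyBounded_iff_ultrafilter.1 hK (f.map φ) (by simp)

/-- If `u` characterizes `τ`, then every homomorphism into a totally bounded group which sends `u`
to a null sequence is `τ`-continuous. -/
theorem CharacterizesTopology.continuous_of_tendsto {G K : Type*} [AddCommGroup G]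
    [AddCommGroup K] [UniformSpace K] [IsUniformAddGroup K]
    (hK : TotallyBounded (Set.univ : Set K)) [τ : TopologicalSpace G] {u : ℕ → G}
    (hu : CharacterizesTopology u τ) (φ : G →+ K) (hφ : Tendsto (fun n => φ (u n)) atTop (𝓝 0)) :
    Continuous φ := by
  obtain ⟨-, ⟨hτ, hu0⟩, hleast⟩ := hu
  have hle : τ ≤ τ ⊓ TopologicalSpace.induced φ inferInstance := by
    refine hleast ⟨hτ.inf_induced hK φ, ?_⟩
    rw [nhds_inf, nhds_induced, map_zero]
    exact tendsto_inf.2 ⟨hu0, tendsto_comap_iff.2 hφ⟩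
  exact continuous_iff_le_induced.2 (hle.trans inf_le_right)

/-- The elements outside a subgroup are detected by characters with countable range that vanish on
the subgroup. -/
theorem AddSubgroup.exists_countable_range_character {G : Type*} [AddCommGroup G]
    (H : AddSubgroup G) {g : G} (hg : g ∉ H) :
    ∃ φ : G →+ UnitAddCircle, (∀ x ∈ H, φ x = 0) ∧ φ g ≠ 0 ∧ (Set.range φ).Countable := by
  have hg' : (QuotientAddGroup.mk' H g) ≠ 0 := by simpa using hg
  obtain ⟨c, hc⟩ := CharacterModule.exists_character_apply_ne_zero_of_ne_zero hg'
  have hmap : AddSubgroup.zmultiples (1 : ℚ) ≤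
      (AddSubgroup.zmultiples (1 : ℝ)).comap (Rat.castHom ℝ : ℚ →+ ℝ) := by
    rw [AddSubgroup.zmultiples_le]
    simp
  -- The inclusion ℚ/ℤ → ℝ/ℤ: the countable group ℚ/ℤ already has enough characters.
  let ι : AddCircle (1 : ℚ) →+ UnitAddCircle := QuotientAddGroup.map _ _ (Rat.castHom ℝ : ℚ →+ ℝ) hmap
  have hι : ∀ x, ι x = 0 → x = 0 := by
    intro x
    induction x using QuotientAddGroup.induction_on with
    | H q =>
      intro h
      obtain ⟨n, hn⟩ := AddSubgroup.mem_zmultiples_iff.1 ((QuotientAddGroup.eq_zero_iff _).1 h)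
      refine (QuotientAddGroup.eq_zero_iff _).2 (AddSubgroup.mem_zmultiples_iff.2 ⟨n, ?_⟩)
      have hn' : ((n • (1 : ℚ) : ℚ) : ℝ) = (q : ℝ) := by simpa using hn
      exact_mod_cast hn'
  have : Countable (AddCircle (1 : ℚ)) := Quotient.countable
  refine ⟨ι.comp ((c : G ⧸ H →+ AddCircle (1 : ℚ)).comp (QuotientAddGroup.mk' H)), ?_, ?_, ?_⟩
  · intro x hx
    have : QuotientAddGroup.mk' H x = 0 := by simpa using hx
    change ι (c (QuotientAddGroup.mk' H x)) = 0
    rw [this, map_zero, map_zero]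
  · exact fun h => hc (hι _ h)
  · refine (Set.countable_range ι).mono ?_
    rintro _ ⟨x, rfl⟩
    exact ⟨_, rfl⟩

/-- A continuous character with countable range that does not vanish at `g` excludes `g` from the
quasi-component. -/
theorem notMem_quasiComponent_of_character {G : Type*} [AddCommGroup G] [TopologicalSpace G]
    {φ : G →+ UnitAddCircle} (hφ : Continuous φ) (hrange : (Set.range φ).Countable) {g : G}
    (hg : φ g ≠ 0) : g ∉ quasiComponent G := by
  have hcount : ((fun x : UnitAddCircle => ‖x‖) '' Set.range φ).Countable := hrange.image _
  -- At a radius that is not a norm value, the open and closed balls have the same preimage.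
  obtain ⟨r, ⟨hr0, hrg⟩, hr⟩ : ∃ r ∈ Set.Ioo 0 ‖φ g‖, r ∉ (‖·‖) '' Set.range φ := by
    by_contra! h
    exact (norm_pos_iff.2 hg).not_ge (Cardinal.Real.Ioo_countable_iff.1 (hcount.mono h))
  have heq : {x | ‖φ x‖ < r} = {x | ‖φ x‖ ≤ r} := by
    ext x
    exact ⟨fun h => le_of_lt (show ‖φ x‖ < r from h), fun h => lt_of_le_of_ne h fun h' => hr ⟨φ x, ⟨x, rfl⟩, h'⟩⟩
  have hclopen : IsClopen {x | ‖φ x‖ < r} :=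
    ⟨heq ▸ isClosed_le hφ.norm continuous_const, isOpen_lt hφ.norm continuous_const⟩
  intro hmem
  have : ‖φ g‖ < r := hmem _ ⟨hclopen, by simpa using hr0⟩
  exact lt_asymm this hrg

theorem connectedComponent_zero_subset_quasiComponent (G : Type*) [AddCommGroup G]
    [TopologicalSpace G] : connectedComponent (0 : G) ⊆ quasiComponent G :=
  fun _ hx _ hZ => hZ.1.connectedComponent_subset hZ.2 hx

/-- A countable preconnected set in a Tychonoff space has at most one point. -/
theorem IsPreconnected.subsingleton_of_countable {X : Type*} [TopologicalSpace X] [T35Space X]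
    {s : Set X} (hs : IsPreconnected s) (hc : s.Countable) : s.Subsingleton := by
  have := hc.totallySeparatedSpace
  exact (totallyDisconnectedSpace_subtype_iff.1 inferInstance) s subset_rfl hs

theorem corollary3p4 {G : Type*} [AddCommGroup G] [τ : TopologicalSpace G]
    (hG : IsSSCharacterized τ) :
    IsHereditarilyDisconnected G ∧
      ∃ H : AddSubgroup G, Countable H ∧ quasiComponent G ⊆ (H : Set G) := by
  obtain ⟨hτ, u, hu⟩ := hG
  let H : AddSubgroup G := (LinearMap.range (Finsupp.linearCombination ℤ u)).toAddSubgroup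
  have hH : (H : Set G).Countable := Set.countable_range (Finsupp.linearCombination ℤ u)
  have huH : ∀ n, u n ∈ H := fun n => ⟨Finsupp.single n 1, by simp⟩
  have hQ : quasiComponent G ⊆ (H : Set G) := by
    intro g hg
    by_contra hgH
    obtain ⟨φ, hφ, hφg, hrange⟩ := H.exists_countable_range_character hgH
    have hφu : Tendsto (fun n => φ (u n)) atTop (𝓝 0) := by
      simp only [hφ _ (huH _), tendsto_const_nhds]
    exact notMem_quasiComponent_of_character
      (hu.continuous_of_tendsto isCompact_univ.totallyBounded φ hφu) hrange hφg hg
  refine ⟨?_, H, hH.to_subtype, hQ⟩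
  have := hτ.toIsTopologicalAddGroup
  have := hτ.toT2Space
  let _ : UniformSpace G := IsTopologicalAddGroup.rightUniformSpace G
  have : T35Space G := {}
  have hcount : (connectedComponent (0 : G)).Countable :=
    hH.mono ((connectedComponent_zero_subset_quasiComponent G).trans hQ)
  exact (isPreconnected_connectedComponent.subsingleton_of_countable hcount).eq_singleton_of_mem
    mem_connectedComponent
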